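/- **Proposition (Bäcklund transformations).** *Quad-graph with boundary.* Let $\mathcal S$ be a simply connected oriented surface whose boundary is nonempty and connected, with a cellular decomposition $\mathcal G$ (finite faces, finite vertex degrees). The associated quad-graph with boundary has as vertex set $V$ the vertices of $\mathcal G$ (black) together with one white vertex in each face of $\mathcal G$. Its bulk edges join each white vertex to the black vertices at the corners of its face, and its boundary edges are the edges of $\mathcal G$ on $\partial\mathcal S$. Each interior edge of $\mathcal G$ gives a quadrilateral (two black and two white vertices). Each boundary edge gives a triangle (two black boundary vertices and one white vertex). *Equations.* Let $P\subseteq\mathbb C$ be a set of admissible parameters, $\sigma:P\to P$, and let $Q(u_{00},u_{10},u_{01},u_{11};a,b)$ and $q(x,y,z;a)$ be complex-valued functions of complex field values and parameters in $P$. "Gives $u$" means that the equation has exactly one solution $u\in\mathbb C$. Suppose: 1. The relation $Q=0$ has the symmetry of the square: $Q(u_{00},u_{10},u_{01},u_{11};a,b)=0\iff Q(u_{10},u_{00},u_{11},u_{01};a,b)=0\iff Q(u_{00},u_{01},u_{10},u_{11};b,a)=0$. 2. $Q$ is 3D consistent: for all $a,b,c\in P$ and all $u_{000},u_{100},u_{010},u_{001}$,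 suppose $Q(u_{000},u_{100},u_{010},u_{110};a,b)=0$, $Q(u_{000},u_{100},u_{001},u_{101};a,c)=0$ and $Q(u_{000},u_{010},u_{001},u_{011};b,c)=0$ give $u_{110},u_{101},u_{011}$. If each of $Q(u_{100},u_{110},u_{101},u_{111};b,c)=0$, $Q(u_{010},u_{110},u_{011},u_{111};a,c)=0$ and $Q(u_{001},u_{101},u_{011},u_{111};a,b)=0$ gives a value of $u_{111}$, then these three values coincide. 3. $(q,\sigma)$ is 3D boundary consistent with $Q$: for all $a,b\in P$ and all $x,x_1,x_2$, suppose - $Q(y_1,x_2,x_1,x;a,b)=0$, $q(x,x_1,y_2;a)=0$, $q(x,x_2,y_3;b)=0$ give $y_1,y_2,y_3$; - $Q(y_1,z_1,x_2,y_3;\sigma(b),a)=0$, $Q(y_1,z_2,x_1,y_2;\sigma(a),b)=0$ give $z_1,z_2$; - each of $q(y_2,z_2,w;b)=0$, $q(y_3,z_1,w;a)=0$, $Q(y_1,z_1,z_2,w;\sigma(b),\sigma(a))=0$ gives a value of $w$. Then these three values of $w$ coincide. *Labelling and solutions.* The bulk edges carry parameters in $P$. Opposite edges of a quadrilateral carry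 the same parameter. Each triangle is read as $(x,y,z)$, with $x,z$ on the boundary, in one chosen direction, and its edges $xy$, $yz$ then carry $a$ and $\sigma(a)$. A solution is a function $g:V\to\mathbb C$ with $Q(g(v_{00}),g(v_{10}),g(v_{01}),g(v_{11});a,b)=0$ on all quadrilaterals ($a$ carried by the edges $v_{00}v_{10}$, $v_{01}v_{11}$, and $b$ by the other two) and $q(g(x),g(y),g(z);a)=0$ on all triangles. *General position.* Let $g$ be a solution, $\lambda\in P$, $v_0\in V$, $c\in\mathbb C$. Start from the value $c$ at $v_0$ and solve $Q(g(v),g(v_1),u,u_1;a,\lambda)=0$ for $u_1$ along all walks of bulk edges; this produces first-floor values. At boundary vertices solve $q(g(v),u,w;\lambda)=0$ for $w$, and then solve $Q(u,u_1,w,w_1;a,\sigma(\lambda))=0$ for $w_1$ along all walks; this produces second-floor values. The pair $(\lambda,c)$ is in general position if none of the face equations met is singular: each of the equations just listed, the bulk equations on the quadrilaterals of the ground, first and second floors, and the boundary equations on the triangles of the ground and second floors gives the value at the last vertex of the face from the values at the others (from every starting corner of a quadrilateral, and in the chosen direction of a triangle). No agreement between values obtained along different walks is assumed. If $Q=0$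 can always be solved uniquely for $u_{11}$ and $q=0$ for $z$, every $(\lambda,c)$ is in general position. *Claim.* For every solution $g$, every vertex $v_0$ and every $(\lambda,c)\in P\times\mathbb C$ in general position, there exist a function $f:V\to\mathbb C$ on the intermediate floor and a solution $g^+:V\to\mathbb C$ of the same system, with $f(v_0)=c$, such that $$Q(g(v),g(v_1),f(v),f(v_1);a,\lambda)=0,\qquad Q(f(v),f(v_1),g^+(v),g^+(v_1);a,\sigma(\lambda))=0$$ for all bulk edges $(v,v_1)$, where $a$ is the parameter of the edge, and $$q(g(v_2),f(v_2),g^+(v_2);\lambda)=0$$ for all boundary vertices $v_2$. The pair $(f,g^+)$ is determined by these equations and $f(v_0)=c$, so that $g^+$ depends on the two parameters $\lambda$ and $c$. -/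

import Mathlib

/-- A cellular decomposition of an oriented surface with boundary, given as a collection of oriented
polygons glued along their sides. The elements of `D` are the sides of the polygons (equivalently,
their corners: a side is identified with the corner at its origin).
* `next d` is the side following `d` around its polygon;
* `opp d` is the side glued to `d` (with reversed orientation); `opp d = d` means that `d` is not
  glued to anything, i.e. that it is an edge on the boundary of the surface.
The vertices of the decomposition are the classes of corners generated by the gluing, the faces are
the cycles of `next`. Faces have finitely many sides and vertices have finite degree; the set of
faces may be infinite (noncompact surfaces). -/
structure CellDecomposition (D : Type*) where
  next : Equiv.Perm D
  opp : D → D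
  opp_opp : ∀ d, opp (opp d) = d
  finite_face : ∀ d, {e | next.SameCycle d e}.Finite
  finite_vertex : ∀ d, {e | Relation.EqvGen (fun x y => opp x ≠ x ∧ y = next (opp x)) d e}.Finite

namespace CellDecomposition

variable {D : Type*} (M : CellDecomposition D)

/-- Black vertices: the vertices of the cellular decomposition. The corner at the origin of `d` and
the corner at the end of the side `opp d` glued to `d` are the same point of the surface. -/
abbrev Black : Type _ := Quot (fun x y : D => M.opp x ≠ x ∧ y = M.next (M.opp x))

/-- White vertices: one inside each face of the cellular decomposition. -/
abbrev White : Type _ := Quotient (Equiv.Perm.SameCycle.setoid M.next)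

/-- The vertices of the quad-graph with boundary. Its edges not on the boundary join the white vertex
of a face to the black vertices at the corners of that face: there is one such edge for each `d : D`,
joining `M.face d` and `M.org d`. Its faces are a quadrilateral for each pair `{d, opp d}` with
`opp d ≠ d` and a triangle for each `d` with `opp d = d`. -/
abbrev Vertex : Type _ := M.Black ⊕ M.White

/-- The black vertex at the origin of the side `d`. -/
def org (d : D) : M.Vertex := Sum.inl (Quot.mk _ d)

/-- The white vertex in the face that has `d` as a side. -/
def face (d : D) : M.Vertex := Sum.inr (Quotient.mk _ d)

/-- The side `d` lies on the boundary of the surface; it goes from `M.org d` to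
`M.org (M.next d)`. -/
def IsBoundary (d : D) : Prop := M.opp d = d

/-- The vertices on the boundary of the surface. -/
def IsBoundaryVertex (v : M.Vertex) : Prop :=
  ∃ d, M.IsBoundary d ∧ (v = M.org d ∨ v = M.org (M.next d))

/-- A step `(d, true)` runs along the edge `d` from `M.org d` to `M.face d`, and `(d, false)` runs
backwards. -/
def source (s : D × Bool) : M.Vertex := if s.2 then M.org s.1 else M.face s.1

/-- The end of a step. -/
def target (s : D × Bool) : M.Vertex := if s.2 then M.face s.1 else M.org s.1

/-- `M.IsWalk v l w`: the list of steps `l` is a walk from `v` to `w` along edges that are not on the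
boundary. -/
def IsWalk : M.Vertex → List (D × Bool) → M.Vertex → Prop
  | v, [], w => v = w
  | v, s :: l, w => M.source s = v ∧ IsWalk (M.target s) l w

/-- Elementary homotopies of walks: removing a backtracking, and replacing one half of the contour of
a quadrilateral by the other half. -/
inductive Move : List (D × Bool) → List (D × Bool) → Prop
  | backtrack (l₁ l₂ : List (D × Bool)) (d : D) (b : Bool) :
      Move (l₁ ++ (d, b) :: (d, !b) :: l₂) (l₁ ++ l₂)
  | quad (l₁ l₂ : List (D × Bool)) (d : D) (h : ¬ M.IsBoundary d) :
      Move (l₁ ++ (d, true) :: (M.next d, false) :: l₂)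
        (l₁ ++ (M.next (M.opp d), true) :: (M.opp d, false) :: l₂)

/-- The surface is connected. -/
def Connected : Prop := ∀ v w : M.Vertex, ∃ l, M.IsWalk v l w

/-- The surface has trivial fundamental group: every closed walk is homotopic to a constant one.
(The triangles and the edges on the boundary do not occur here: every triangle has precisely one
side on the boundary, and that side belongs to no other face, so that the surface retracts onto the
union of the quadrilaterals and of the edges that are not on the boundary.) -/
def SimplyConnected : Prop :=
  ∀ (v : M.Vertex) (l : List (D × Bool)), M.IsWalk v l v →
    Relation.EqvGen (fun l₁ l₂ => M.IsWalk v l₁ v ∧ M.IsWalk v l₂ v ∧ M.Move l₁ l₂) l []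

/-- The boundary of the surface is nonempty and connected: any two edges on the boundary are joined
by a chain of consecutive edges on the boundary. -/
def ConnectedBoundary : Prop :=
  (∃ d, M.IsBoundary d) ∧
  ∀ d e, M.IsBoundary d → M.IsBoundary e →
    Relation.EqvGen
      (fun x y => M.IsBoundary x ∧ M.IsBoundary y ∧ M.org (M.next x) = M.org y) d e

end CellDecomposition

/-- The functions that define a discrete system on quad-graphs with boundary: the bulk equation
`Q u00 u10 u01 u11 a b = 0`, the boundary equation `q x y z a = 0` and the map `σ` on parameters.
`params` is the set of values allowed for the parameters (it may be all of `ℂ`). -/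
structure BoundarySystem where
  params : Set ℂ
  Q : ℂ → ℂ → ℂ → ℂ → ℂ → ℂ → ℂ
  q : ℂ → ℂ → ℂ → ℂ → ℂ
  σ : ℂ → ℂ
  σ_mem : ∀ a ∈ params, σ a ∈ params

/-- `u` is the value given by the equation `p u = 0`: its one and only solution. -/
def IsOnlyRoot (p : ℂ → ℂ) (u : ℂ) : Prop := ∀ w, p w = 0 ↔ w = u

namespace BoundarySystem

variable (E : BoundarySystem)

/-- The equation `Q = 0` does not depend on how the vertices of a quadrilateral are read off
(symmetry under the dihedral group of the square, `a` being carried by the edges `u00 u10` and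
`u01 u11` and `b` by the edges `u00 u01` and `u10 u11`). -/
def IsSymmetric : Prop :=
  ∀ a ∈ E.params, ∀ b ∈ E.params, ∀ u00 u10 u01 u11 : ℂ,
    (E.Q u00 u10 u01 u11 a b = 0 ↔ E.Q u10 u00 u11 u01 a b = 0) ∧
    (E.Q u00 u10 u01 u11 a b = 0 ↔ E.Q u00 u01 u10 u11 b a = 0)

/-- 3D consistency: if the equations on the three faces of a cube at `u000` give values of `u110`,
`u101`, `u011`, and each of the three other faces then gives a value of `u111`, these three values
coincide. -/
def Consistent3D : Prop :=
  ∀ a ∈ E.params, ∀ b ∈ E.params, ∀ c ∈ E.params,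
  ∀ u000 u100 u010 u001 u110 u101 u011 r s t : ℂ,
    IsOnlyRoot (fun u => E.Q u000 u100 u010 u a b) u110 →
    IsOnlyRoot (fun u => E.Q u000 u100 u001 u a c) u101 →
    IsOnlyRoot (fun u => E.Q u000 u010 u001 u b c) u011 →
    IsOnlyRoot (fun u => E.Q u100 u110 u101 u b c) r →
    IsOnlyRoot (fun u => E.Q u010 u110 u011 u a c) s →
    IsOnlyRoot (fun u => E.Q u001 u101 u011 u a b) t →
    r = s ∧ s = t

/-- 3D boundary consistency, on a half of a rhombic dodecahedron: the three ways to compute the last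
value from `x`, `x1`, `x2` give the same answer whenever all the equations give values. -/
def BoundaryConsistent3D : Prop :=
  ∀ a ∈ E.params, ∀ b ∈ E.params, ∀ x x1 x2 y1 y2 y3 z1 z2 r s t : ℂ,
    IsOnlyRoot (fun u => E.Q u x2 x1 x a b) y1 →
    IsOnlyRoot (fun u => E.q x x1 u a) y2 →
    IsOnlyRoot (fun u => E.q x x2 u b) y3 →
    IsOnlyRoot (fun u => E.Q y1 u x2 y3 (E.σ b) a) z1 →
    IsOnlyRoot (fun u => E.Q y1 u x1 y2 (E.σ a) b) z2 →
    IsOnlyRoot (fun u => E.q y2 z2 u b) r →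
    IsOnlyRoot (fun u => E.q y3 z1 u a) s →
    IsOnlyRoot (fun u => E.Q y1 z1 z2 u (E.σ b) (E.σ a)) t →
    r = s ∧ s = t

/-- `Q` is 3D consistent (and symmetric, so that it can be attached to quadrilaterals) and `(q, σ)`
is 3D boundary consistent. -/
structure Integrable : Prop where
  symmetric : E.IsSymmetric
  consistent : E.Consistent3D
  boundary_consistent : E.BoundaryConsistent3D

end BoundarySystem

/-- A compatible labelling of the edges not on the boundary of a quad-graph with boundary. Opposite
edges of a quadrilateral carry the same parameter. The triangle of a side `d` on the boundary is read
in one of two directions, from `org d` to `org (next d)` if `forward d = true` and the other way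
around if `forward d = false`; in this direction its edges carry `a` and `σ a`. -/
structure Labelling {D : Type*} (M : CellDecomposition D) (E : BoundarySystem) where
  label : D → ℂ
  forward : D → Bool
  label_mem : ∀ d, label d ∈ E.params
  label_opp : ∀ d, ¬ M.IsBoundary d → label (M.opp d) = label d
  label_next_opp : ∀ d, ¬ M.IsBoundary d → label (M.next (M.opp d)) = label (M.next d)
  label_forward : ∀ d, M.IsBoundary d → forward d = true → label (M.next d) = E.σ (label d)
  label_backward : ∀ d, M.IsBoundary d → forward d = false → label d = E.σ (label (M.next d))

namespace Labelling

variable {D : Type*} {M : CellDecomposition D} {E : BoundarySystem} (L : Labelling M E)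

/-- `L.IsEdge v v1 a`: `v` and `v1` are the ends of an edge not on the boundary with parameter
`a`. -/
inductive IsEdge : M.Vertex → M.Vertex → ℂ → Prop
  | black (d : D) : IsEdge (M.org d) (M.face d) (L.label d)
  | white (d : D) : IsEdge (M.face d) (M.org d) (L.label d)

/-- `L.IsQuad v00 v10 v01 v11 a b`: these are the vertices of a quadrilateral face, the parallel
edges `v00 v10`, `v01 v11` carry `a` and the parallel edges `v00 v01`, `v10 v11` carry `b`. -/
inductive IsQuad : M.Vertex → M.Vertex → M.Vertex → M.Vertex → ℂ → ℂ → Prop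
  | black (d : D) (h : ¬ M.IsBoundary d) :
      IsQuad (M.org d) (M.face d) (M.face (M.opp d)) (M.org (M.opp d))
        (L.label d) (L.label (M.next (M.opp d)))
  | white (d : D) (h : ¬ M.IsBoundary d) :
      IsQuad (M.face d) (M.org d) (M.org (M.next d)) (M.face (M.opp d))
        (L.label d) (L.label (M.next d))

/-- `L.IsTriangle x y z a`: these are the vertices of a triangular face, with `x` and `z` on the
boundary; the edge `x y` carries `a` and the edge `y z` carries `σ a`. -/
inductive IsTriangle : M.Vertex → M.Vertex → M.Vertex → ℂ → Prop
  | forward (d : D) (h : M.IsBoundary d) (hf : L.forward d = true) :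
      IsTriangle (M.org d) (M.face d) (M.org (M.next d)) (L.label d)
  | backward (d : D) (h : M.IsBoundary d) (hf : L.forward d = false) :
      IsTriangle (M.org (M.next d)) (M.face d) (M.org d) (L.label (M.next d))

/-- The field `g` satisfies the bulk equation on all quadrilaterals and the boundary equation on all
triangles. -/
def IsSolution (g : M.Vertex → ℂ) : Prop :=
  (∀ v00 v10 v01 v11 a b, L.IsQuad v00 v10 v01 v11 a b →
    E.Q (g v00) (g v10) (g v01) (g v11) a b = 0) ∧
  (∀ x y z a, L.IsTriangle x y z a → E.q (g x) (g y) (g z) a = 0)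

/-- The values that occur at the vertices of the first floor when one starts from the value `c` at
the vertex `v0` and solves the equations of the vertical quadrilaterals above the edges, along all
possible walks. (That every vertex receives only one value is not part of the definition.) -/
inductive FirstFloor (g : M.Vertex → ℂ) (lam : ℂ) (v0 : M.Vertex) (c : ℂ) : M.Vertex → ℂ → Prop
  | base : FirstFloor g lam v0 c v0 c
  | step {v v1 : M.Vertex} {a u u1 : ℂ} (h : FirstFloor g lam v0 c v u) (he : L.IsEdge v v1 a)
      (hu : E.Q (g v) (g v1) u u1 a lam = 0) : FirstFloor g lam v0 c v1 u1

/-- The values `u` on the first floor and `w` on the second floor that occur at the same vertex when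
one solves the equation of the vertical triangle above some boundary vertex, and then the equations
of the vertical quadrilaterals along all possible walks. -/
inductive SecondFloor (g : M.Vertex → ℂ) (lam : ℂ) (v0 : M.Vertex) (c : ℂ) :
    M.Vertex → ℂ → ℂ → Prop
  | base {v : M.Vertex} {u w : ℂ} (h : L.FirstFloor g lam v0 c v u) (hv : M.IsBoundaryVertex v)
      (hw : E.q (g v) u w lam = 0) : SecondFloor g lam v0 c v u w
  | step {v v1 : M.Vertex} {a u u1 w w1 : ℂ} (h : SecondFloor g lam v0 c v u w)
      (he : L.IsEdge v v1 a) (hu : E.Q (g v) (g v1) u u1 a lam = 0)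
      (hw : E.Q u u1 w w1 a (E.σ lam) = 0) : SecondFloor g lam v0 c v1 u1 w1

/-- The parameters `lam` and `c` (the value at `v0` on the first floor) are in general position with
respect to the field `g`: none of the face equations met on the three floors and between them is
singular, i.e. each determines the last value on the face from the other ones. Nothing is required
about the agreement of values computed in different ways. -/
structure GeneralPosition (g : M.Vertex → ℂ) (lam : ℂ) (v0 : M.Vertex) (c : ℂ) : Prop where
  ground_quad : ∀ {v00 v10 v01 v11 : M.Vertex} {a b : ℂ}, L.IsQuad v00 v10 v01 v11 a b →
    ∃! u, E.Q (g v00) (g v10) (g v01) u a b = 0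
  ground_triangle : ∀ {x y z : M.Vertex} {a : ℂ}, L.IsTriangle x y z a →
    ∃! u, E.q (g x) (g y) u a = 0
  first_edge : ∀ {v v1 : M.Vertex} {a u : ℂ}, L.FirstFloor g lam v0 c v u → L.IsEdge v v1 a →
    ∃! u1, E.Q (g v) (g v1) u u1 a lam = 0
  first_quad : ∀ {v00 v10 v01 v11 : M.Vertex} {a b u00 u10 u01 : ℂ},
    L.FirstFloor g lam v0 c v00 u00 → L.IsQuad v00 v10 v01 v11 a b →
    E.Q (g v00) (g v10) u00 u10 a lam = 0 → E.Q (g v00) (g v01) u00 u01 b lam = 0 →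
    ∃! u11, E.Q u00 u10 u01 u11 a b = 0
  boundary_vertex : ∀ {v : M.Vertex} {u : ℂ}, L.FirstFloor g lam v0 c v u →
    M.IsBoundaryVertex v → ∃! w, E.q (g v) u w lam = 0
  second_edge : ∀ {v v1 : M.Vertex} {a u u1 w : ℂ}, L.SecondFloor g lam v0 c v u w →
    L.IsEdge v v1 a → E.Q (g v) (g v1) u u1 a lam = 0 →
    ∃! w1, E.Q u u1 w w1 a (E.σ lam) = 0
  second_quad : ∀ {v00 v10 v01 v11 : M.Vertex} {a b u00 u10 u01 w00 w10 w01 : ℂ},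
    L.SecondFloor g lam v0 c v00 u00 w00 → L.IsQuad v00 v10 v01 v11 a b →
    E.Q (g v00) (g v10) u00 u10 a lam = 0 → E.Q (g v00) (g v01) u00 u01 b lam = 0 →
    E.Q u00 u10 w00 w10 a (E.σ lam) = 0 → E.Q u00 u01 w00 w01 b (E.σ lam) = 0 →
    ∃! w11, E.Q w00 w10 w01 w11 a b = 0
  second_triangle : ∀ {x y z : M.Vertex} {a u u1 w w1 : ℂ},
    L.SecondFloor g lam v0 c x u w → L.IsTriangle x y z a →
    E.Q (g x) (g y) u u1 a lam = 0 → E.Q u u1 w w1 a (E.σ lam) = 0 →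
    ∃! w2, E.q w w1 w2 a = 0

/-- `gp` is related to `g` through the function `f` on the intermediate floor, with parameter
`lam`. -/
structure IsBacklundPair (g : M.Vertex → ℂ) (lam : ℂ) (f gp : M.Vertex → ℂ) : Prop where
  ground_first : ∀ v v1 a, L.IsEdge v v1 a → E.Q (g v) (g v1) (f v) (f v1) a lam = 0
  first_second : ∀ v v1 a, L.IsEdge v v1 a → E.Q (f v) (f v1) (gp v) (gp v1) a (E.σ lam) = 0
  boundary : ∀ v, M.IsBoundaryVertex v → E.q (g v) (f v) (gp v) lam = 0

end Labelling

/-! The equation `Q = 0` on the quadrilaterals above the edges transports values on a floor from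
vertex to vertex. Nonsingularity makes this transport a function, the symmetry of `Q` makes it
reversible, and 3D consistency on the cube over a quadrilateral makes its holonomy trivial: it is a
flat connection (`IsRegular.isFlat`). On a simply connected surface it therefore has a section
through `c`, which is `f`, and the top faces of the cubes give the bulk equation for `f`
(`IsRegular.cube`). Since equations are known to be nonsingular only at values actually reached, a
predicate `Good` on values accompanies the transport.

The same argument with `f` as ground and parameter `σ lam` yields `gp`, started from the solution of
`q = 0` above a single boundary vertex. What remains is `q = 0` above the other boundary vertices
and on the upper triangles. Boundary consistency, applied to the half dodecahedron over a triangle,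
gives both and carries the vertical equation across the triangle in its chosen direction
(`half_dodecahedron`); uniqueness of sections gives the opposite direction (`boundary_eq`).
Connectedness of the boundary then reaches every boundary vertex. -/

namespace CellDecomposition

variable {D : Type*} {M : CellDecomposition D}

/-! ### Gluing identities, walks and lifts. -/

theorem org_next_opp {d : D} (h : ¬ M.IsBoundary d) : M.org (M.next (M.opp d)) = M.org d :=
  congrArg Sum.inl (Quot.sound ⟨h, rfl⟩).symm

theorem face_next (d : D) : M.face (M.next d) = M.face d :=
  congrArg Sum.inr (Quotient.sound (Equiv.Perm.SameCycle.symm ⟨1, by simp⟩))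

theorem not_isBoundary_opp {d : D} (h : ¬ M.IsBoundary d) : ¬ M.IsBoundary (M.opp d) := by
  intro h'
  unfold IsBoundary at h h'
  rw [M.opp_opp] at h'
  exact h h'.symm

theorem org_opp {d : D} (h : ¬ M.IsBoundary d) : M.org (M.opp d) = M.org (M.next d) := by
  have := org_next_opp (not_isBoundary_opp h)
  rw [M.opp_opp] at this
  exact this.symm

theorem isWalk_append {l₁ l₂ : List (D × Bool)} {v w : M.Vertex} :
    M.IsWalk v (l₁ ++ l₂) w ↔ ∃ m, M.IsWalk v l₁ m ∧ M.IsWalk m l₂ w := by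
  induction l₁ generalizing v with
  | nil => simp [IsWalk]
  | cons s l ih => simp [IsWalk, ih, and_assoc]

/-- The step `s` run backwards. -/
def revStep (s : D × Bool) : D × Bool := (s.1, !s.2)

theorem source_revStep (s : D × Bool) : M.source (revStep s) = M.target s := by
  rcases s with ⟨d, _ | _⟩ <;> rfl

theorem target_revStep (s : D × Bool) : M.target (revStep s) = M.source s := by
  rcases s with ⟨d, _ | _⟩ <;> rfl

/-- `LiftsAlong R l u w`: transporting `u` along the steps of `l` by the relation `R` can give `w`. -/
def LiftsAlong {α : Type*} (R : D × Bool → α → α → Prop) : List (D × Bool) → α → α → Prop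
  | [], u, w => u = w
  | s :: l, u, w => ∃ m, R s u m ∧ LiftsAlong R l m w

theorem liftsAlong_append {α : Type*} {R : D × Bool → α → α → Prop} {l₁ l₂ : List (D × Bool)}
    {u w : α} :
    LiftsAlong R (l₁ ++ l₂) u w ↔ ∃ m, LiftsAlong R l₁ u m ∧ LiftsAlong R l₂ m w := by
  induction l₁ generalizing u with
  | nil => simp [LiftsAlong]
  | cons s l ih =>
    simp only [List.cons_append, LiftsAlong, ih]
    constructor
    · rintro ⟨a, h, b, h1, h2⟩
      exact ⟨b, ⟨a, h, h1⟩, h2⟩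
    · rintro ⟨b, ⟨a, h, h1⟩, h2⟩
      exact ⟨a, h, b, h1, h2⟩

/-- A flat transport of values along the steps: on the values allowed by `Good` it is a function, it
is inverted by running a step backwards, and it has trivial holonomy around quadrilaterals. -/
structure IsFlat {α : Type*} (M : CellDecomposition D) (Good : M.Vertex → α → Prop)
    (R : D × Bool → α → α → Prop) : Prop where
  exists_unique : ∀ s u, Good (M.source s) u → ∃! w, R s u w
  good : ∀ s u w, Good (M.source s) u → R s u w → Good (M.target s) w
  symm : ∀ s u w, R s u w → R (revStep s) w u
  quad : ∀ d, ¬ M.IsBoundary d → ∀ u u₁ u₂ w₁ w₂, Good (M.org d) u →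
    R (d, true) u u₁ → R (M.next d, false) u₁ w₁ →
    R (M.next (M.opp d), true) u u₂ → R (M.opp d, false) u₂ w₂ → w₁ = w₂

/-! ### Homotopy invariance of lifts and sections of flat transports. -/

namespace IsFlat

variable {α : Type*} {Good : M.Vertex → α → Prop} {R : D × Bool → α → α → Prop}

theorem exists_lift (H : IsFlat M Good R) {l : List (D × Bool)} {v w : M.Vertex} {u : α}
    (hu : Good v u) (hl : M.IsWalk v l w) : ∃ u', LiftsAlong R l u u' := by
  induction l generalizing v u with
  | nil => exact ⟨u, rfl⟩
  | cons s l ih =>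
    obtain ⟨rfl, hl⟩ := hl
    obtain ⟨m, hm, -⟩ := H.exists_unique s u hu
    obtain ⟨u', h'⟩ := ih (H.good s u m hu hm) hl
    exact ⟨u', m, hm, h'⟩

theorem good_lift (H : IsFlat M Good R) {l : List (D × Bool)} {v w : M.Vertex} {u u' : α}
    (hu : Good v u) (hl : M.IsWalk v l w) (h : LiftsAlong R l u u') : Good w u' := by
  induction l generalizing v u with
  | nil => cases hl; cases h; exact hu
  | cons s l ih =>
    obtain ⟨rfl, hl⟩ := hl
    obtain ⟨m, hm, h⟩ := h
    exact ih (H.good s u m hu hm) hl h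

theorem lift_unique (H : IsFlat M Good R) {l : List (D × Bool)} {v w : M.Vertex} {u a b : α}
    (hu : Good v u) (hl : M.IsWalk v l w) (ha : LiftsAlong R l u a) (hb : LiftsAlong R l u b) :
    a = b := by
  induction l generalizing v u with
  | nil => exact ha.symm.trans hb
  | cons s l ih =>
    obtain ⟨rfl, hl⟩ := hl
    obtain ⟨m, hm, ha⟩ := ha
    obtain ⟨n, hn, hb⟩ := hb
    cases (H.exists_unique s u hu).unique hm hn
    exact ih (H.good s u m hu hm) hl ha hb

/-- A backtracking returns to the value it left, by `symm` and uniqueness. For a quadrilateral, the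
other half of the contour can be lifted because the value is still `Good`, and `quad` makes the two
ends agree. -/
theorem lift_of_move (H : IsFlat M Good R) {l₁ l₂ : List (D × Bool)} {v w : M.Vertex} {u a : α}
    (hu : Good v u) (hl : M.IsWalk v l₁ w) (hm : M.Move l₁ l₂) (ha : LiftsAlong R l₁ u a) :
    LiftsAlong R l₂ u a := by
  cases hm with
  | backtrack k₁ k₂ d b =>
    obtain ⟨p, hk, rfl, -, -⟩ := isWalk_append.1 hl
    obtain ⟨x, hx, y, hy, z, hz, h⟩ := liftsAlong_append.1 ha
    have gx := H.good_lift hu hk hx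
    have gy := H.good _ _ _ gx hy
    rw [← source_revStep] at gy
    cases (H.exists_unique _ _ gy).unique hz (H.symm _ _ _ hy)
    exact liftsAlong_append.2 ⟨_, hx, h⟩
  | quad k₁ k₂ d hd =>
    obtain ⟨p, hk, rfl, -, -⟩ := isWalk_append.1 hl
    obtain ⟨x, hx, y, hy, z, hz, h⟩ := liftsAlong_append.1 ha
    have gx : Good (M.org d) x := H.good_lift hu hk hx
    have gx' : Good (M.source (M.next (M.opp d), true)) x := by
      change Good (M.org _) x
      rwa [org_next_opp hd]
    obtain ⟨y', hy', -⟩ := H.exists_unique _ _ gx'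
    have gy' : Good (M.source (M.opp d, false)) y' := by
      have : Good (M.face _) y' := H.good _ _ _ gx' hy'
      rwa [face_next] at this
    obtain ⟨z', hz', -⟩ := H.exists_unique _ _ gy'
    cases H.quad d hd _ _ _ _ _ gx hy hz hy' hz'
    exact liftsAlong_append.2 ⟨_, hx, y', hy', _, hz', h⟩

theorem lift_iff_of_homotopic (H : IsFlat M Good R) {l₁ l₂ : List (D × Bool)} {v : M.Vertex} {u : α}
    (hu : Good v u)
    (h : Relation.EqvGen (fun l₁ l₂ => M.IsWalk v l₁ v ∧ M.IsWalk v l₂ v ∧ M.Move l₁ l₂) l₁ l₂)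
    (a : α) : LiftsAlong R l₁ u a ↔ LiftsAlong R l₂ u a := by
  induction h with
  | rel l₁ l₂ h =>
    obtain ⟨h₁, h₂, hm⟩ := h
    -- Moves are directed; the converse follows by lifting `l₁`, pushing that lift to `l₂` and using
    -- uniqueness there.
    refine ⟨H.lift_of_move hu h₁ hm, fun ha => ?_⟩
    obtain ⟨b, hb⟩ := H.exists_lift hu h₁
    cases H.lift_unique hu h₂ ha (H.lift_of_move hu h₁ hm hb)
    exact hb
  | refl => rfl
  | symm _ _ _ ih => exact ih.symm
  | trans _ _ _ _ _ ih₁ ih₂ => exact ih₁.trans ih₂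

theorem exists_reverse (H : IsFlat M Good R) {l : List (D × Bool)} {v w : M.Vertex}
    (hl : M.IsWalk v l w) :
    ∃ l', M.IsWalk w l' v ∧ ∀ u a, LiftsAlong R l u a ↔ LiftsAlong R l' a u := by
  induction l generalizing v with
  | nil => cases hl; exact ⟨[], rfl, fun u a => eq_comm⟩
  | cons s l ih =>
    obtain ⟨rfl, hl⟩ := hl
    obtain ⟨l', hl', h⟩ := ih hl
    refine ⟨l' ++ [revStep s], isWalk_append.2
      ⟨_, hl', source_revStep s, target_revStep s⟩, fun u a => ?_⟩
    rw [liftsAlong_append]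
    simp only [LiftsAlong]
    constructor
    · rintro ⟨m, hm, hma⟩
      exact ⟨m, (h _ _).1 hma, u, H.symm _ _ _ hm, rfl⟩
    · rintro ⟨m, hm, x, hx, rfl⟩
      have := H.symm _ _ _ hx
      rw [show revStep (revStep s) = s by simp [revStep]] at this
      exact ⟨m, this, (h _ _).2 hm⟩

/-- Going out along `l₂` and back along the reverse of `l₁` is a null-homotopic loop, so its lift
closes up at `u`; reversing the return leg shows that `l₁` also leads to `b`. -/
theorem lift_eq (H : IsFlat M Good R) (hs : M.SimplyConnected) {l₁ l₂ : List (D × Bool)}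
    {v w : M.Vertex} {u a b : α} (hu : Good v u) (h₁ : M.IsWalk v l₁ w) (h₂ : M.IsWalk v l₂ w)
    (ha : LiftsAlong R l₁ u a) (hb : LiftsAlong R l₂ u b) : a = b := by
  obtain ⟨l', hl', hr⟩ := H.exists_reverse h₁
  obtain ⟨x, hx⟩ := H.exists_lift (H.good_lift hu h₂ hb) hl'
  have hc : M.IsWalk v (l₂ ++ l') v := isWalk_append.2 ⟨_, h₂, hl'⟩
  have : LiftsAlong R [] u x :=
    (H.lift_iff_of_homotopic hu (hs v _ hc) x).1 (liftsAlong_append.2 ⟨_, hb, hx⟩)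
  cases this
  exact H.lift_unique hu h₁ ha ((hr _ _).2 hx)

/-- A flat transport on a simply connected surface has a section through every allowed value. -/
theorem exists_section (H : IsFlat M Good R) (hc : M.Connected) (hs : M.SimplyConnected)
    {v : M.Vertex} {u : α} (hu : Good v u) :
    ∃ F : M.Vertex → α, F v = u ∧ (∀ w, Good w (F w)) ∧
      ∀ s, R s (F (M.source s)) (F (M.target s)) := by
  choose l hl using hc v
  choose F hF using fun w => H.exists_lift hu (hl w)
  refine ⟨F, H.lift_eq hs hu (hl v) (l₂ := []) rfl (hF v) rfl,
    fun w => H.good_lift hu (hl w) (hF w), fun s => ?_⟩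
  obtain ⟨m, hm, -⟩ := H.exists_unique s _ (H.good_lift hu (hl _) (hF _))
  -- The walk chosen for the target and the walk chosen for the source extended by `s` have the same
  -- ends.
  have : F (M.target s) = m :=
    H.lift_eq hs hu (hl _) (l₂ := l (M.source s) ++ [s])
      (isWalk_append.2 ⟨M.source s, hl _, rfl, rfl⟩) (hF _)
      (liftsAlong_append.2 ⟨F (M.source s), hF _, m, hm, rfl⟩)
  rwa [this]

/-- Any section is a lift of its initial value along every walk, so connectedness suffices. -/
theorem section_unique (H : IsFlat M Good R) (hc : M.Connected) {v : M.Vertex}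
    {F G : M.Vertex → α} (hv : Good v (F v)) (h : G v = F v)
    (hF : ∀ s, R s (F (M.source s)) (F (M.target s)))
    (hG : ∀ s, R s (G (M.source s)) (G (M.target s))) : G = F := by
  funext w
  obtain ⟨l, hl⟩ := hc v w
  have key : ∀ (K : M.Vertex → α), (∀ s, R s (K (M.source s)) (K (M.target s))) →
      ∀ (l : List (D × Bool)) (v : M.Vertex), M.IsWalk v l w → LiftsAlong R l (K v) (K w) := by
    intro K hK l
    induction l with
    | nil => intro v h; cases h; rfl
    | cons s l ih =>
      rintro v ⟨rfl, h⟩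
      exact ⟨_, hK s, ih _ h⟩
  exact H.lift_unique hv hl (h ▸ key G hG l v hl) (key F hF l v hl)

end IsFlat

end CellDecomposition

theorem isOnlyRoot_of_existsUnique {p : ℂ → ℂ} {u : ℂ} (h : ∃! w, p w = 0) (hu : p u = 0) :
    IsOnlyRoot p u :=
  fun _ => ⟨fun hw => h.unique hw hu, fun hw => hw ▸ hu⟩

/-! ### Symmetries of the bulk equation. -/

namespace BoundarySystem

variable {E : BoundarySystem}

theorem IsSymmetric.flip_first (h : E.IsSymmetric) {a b u00 u10 u01 u11 : ℂ} (ha : a ∈ E.params)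
    (hb : b ∈ E.params) (hQ : E.Q u00 u10 u01 u11 a b = 0) : E.Q u10 u00 u11 u01 a b = 0 :=
  (h a ha b hb _ _ _ _).1.1 hQ

theorem IsSymmetric.swap (h : E.IsSymmetric) {a b u00 u10 u01 u11 : ℂ} (ha : a ∈ E.params)
    (hb : b ∈ E.params) (hQ : E.Q u00 u10 u01 u11 a b = 0) : E.Q u00 u01 u10 u11 b a = 0 :=
  (h a ha b hb _ _ _ _).2.1 hQ

theorem IsSymmetric.flip_second (h : E.IsSymmetric) {a b u00 u10 u01 u11 : ℂ} (ha : a ∈ E.params)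
    (hb : b ∈ E.params) (hQ : E.Q u00 u10 u01 u11 a b = 0) : E.Q u01 u11 u00 u10 a b = 0 :=
  h.swap hb ha (h.flip_first hb ha (h.swap ha hb hQ))

end BoundarySystem

/-! ### Edges of the faces, and transport between consecutive floors. -/

namespace Labelling

open CellDecomposition

variable {D : Type*} {M : CellDecomposition D} {E : BoundarySystem} {L : Labelling M E}

theorem IsEdge.mem {v v1 : M.Vertex} {a : ℂ} (h : L.IsEdge v v1 a) : a ∈ E.params := by
  cases h <;> exact L.label_mem _

theorem isEdge_step (s : D × Bool) : L.IsEdge (M.source s) (M.target s) (L.label s.1) := by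
  rcases s with ⟨d, _ | _⟩
  · exact .white d
  · exact .black d

theorem IsEdge.exists_step {v v1 : M.Vertex} {a : ℂ} (h : L.IsEdge v v1 a) :
    ∃ s : D × Bool, M.source s = v ∧ M.target s = v1 ∧ L.label s.1 = a := by
  cases h with
  | black d => exact ⟨(d, true), rfl, rfl, rfl⟩
  | white d => exact ⟨(d, false), rfl, rfl, rfl⟩

theorem IsQuad.edges {v00 v10 v01 v11 : M.Vertex} {a b : ℂ} (h : L.IsQuad v00 v10 v01 v11 a b) :
    L.IsEdge v00 v10 a ∧ L.IsEdge v01 v11 a ∧ L.IsEdge v00 v01 b ∧ L.IsEdge v10 v11 b := by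
  cases h with
  | black d h =>
    refine ⟨.black d, ?_, ?_, ?_⟩
    · rw [← L.label_opp d h]
      exact .white _
    · rw [← org_next_opp h, ← face_next (M.opp d)]
      exact .black _
    · rw [org_opp h, ← face_next d, L.label_next_opp d h]
      exact .white _
  | white d h =>
    refine ⟨.white d, ?_, ?_, ?_⟩
    · rw [← L.label_opp d h, ← org_opp h]
      exact .black _
    · rw [← face_next d]
      exact .white _
    · rw [← org_next_opp h, ← face_next (M.opp d), ← L.label_next_opp d h]
      exact .black _

theorem IsTriangle.edges {x y z : M.Vertex} {a : ℂ} (h : L.IsTriangle x y z a) :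
    L.IsEdge x y a ∧ L.IsEdge y z (E.σ a) := by
  cases h with
  | forward d h hf =>
    refine ⟨.black d, ?_⟩
    rw [← L.label_forward d h hf, ← face_next d]
    exact .white _
  | backward d h hf =>
    rw [← L.label_backward d h hf]
    refine ⟨?_, .white d⟩
    rw [← face_next d]
    exact .black _

theorem IsTriangle.isBoundaryVertex {x y z : M.Vertex} {a : ℂ} (h : L.IsTriangle x y z a) :
    M.IsBoundaryVertex x ∧ M.IsBoundaryVertex z := by
  cases h with
  | forward d h hf => exact ⟨⟨d, h, .inl rfl⟩, ⟨d, h, .inr rfl⟩⟩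
  | backward d h hf => exact ⟨⟨d, h, .inr rfl⟩, ⟨d, h, .inl rfl⟩⟩

/-- The transport of values by the equation on the quadrilaterals over the edges of the floor with
the field `g`. -/
def Transport (L : Labelling M E) (g : M.Vertex → ℂ) (lam : ℂ) (s : D × Bool) (u w : ℂ) : Prop :=
  E.Q (g (M.source s)) (g (M.target s)) u w (L.label s.1) lam = 0

/-- No equation is singular on the floor with the field `g` and between this floor and the values
`Good` on the floor above it. -/
structure IsRegular (L : Labelling M E) (g : M.Vertex → ℂ) (lam : ℂ)
    (Good : M.Vertex → ℂ → Prop) : Prop where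
  mem : lam ∈ E.params
  quad_eq : ∀ {v00 v10 v01 v11 : M.Vertex} {a b : ℂ}, L.IsQuad v00 v10 v01 v11 a b →
    E.Q (g v00) (g v10) (g v01) (g v11) a b = 0
  quad : ∀ {v00 v10 v01 v11 : M.Vertex} {a b : ℂ}, L.IsQuad v00 v10 v01 v11 a b →
    ∃! u, E.Q (g v00) (g v10) (g v01) u a b = 0
  edge : ∀ {v v1 : M.Vertex} {a u : ℂ}, Good v u → L.IsEdge v v1 a →
    ∃! u1, E.Q (g v) (g v1) u u1 a lam = 0
  good : ∀ {v v1 : M.Vertex} {a u u1 : ℂ}, Good v u → L.IsEdge v v1 a →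
    E.Q (g v) (g v1) u u1 a lam = 0 → Good v1 u1
  upper_quad : ∀ {v00 v10 v01 v11 : M.Vertex} {a b u00 u10 u01 : ℂ},
    Good v00 u00 → L.IsQuad v00 v10 v01 v11 a b →
    E.Q (g v00) (g v10) u00 u10 a lam = 0 → E.Q (g v00) (g v01) u00 u01 b lam = 0 →
    ∃! u11, E.Q u00 u10 u01 u11 a b = 0

/-! ### Flatness from 3D consistency. -/

namespace IsRegular

variable {g : M.Vertex → ℂ} {lam : ℂ} {Good : M.Vertex → ℂ → Prop}

/-- This is 3D consistency with vertical parameter `lam`. The agreement of the two side faces gives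
flatness; the agreement with the value `t` of the top face makes sections satisfy the bulk equation.
-/
theorem cube (H : IsRegular L g lam Good) (hE : E.Consistent3D)
    {v00 v10 v01 v11 : M.Vertex} {a b u00 u10 u01 r s : ℂ}
    (hu : Good v00 u00) (hq : L.IsQuad v00 v10 v01 v11 a b)
    (h10 : E.Q (g v00) (g v10) u00 u10 a lam = 0) (h01 : E.Q (g v00) (g v01) u00 u01 b lam = 0)
    (hr : E.Q (g v10) (g v11) u10 r b lam = 0) (hs : E.Q (g v01) (g v11) u01 s a lam = 0) :
    r = s ∧ E.Q u00 u10 u01 s a b = 0 := by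
  obtain ⟨e1, e2, e3, e4⟩ := hq.edges
  obtain ⟨t, ht, -⟩ := id (H.upper_quad hu hq h10 h01)
  obtain ⟨h, h'⟩ := hE a e1.mem b e3.mem lam H.mem _ _ _ _ _ _ _ r s t
    (isOnlyRoot_of_existsUnique (H.quad hq) (H.quad_eq hq))
    (isOnlyRoot_of_existsUnique (H.edge hu e1) h10)
    (isOnlyRoot_of_existsUnique (H.edge hu e3) h01)
    (isOnlyRoot_of_existsUnique (H.edge (H.good hu e1 h10) e4) hr)
    (isOnlyRoot_of_existsUnique (H.edge (H.good hu e3 h01) e2) hs)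
    (isOnlyRoot_of_existsUnique (H.upper_quad hu hq h10 h01) ht)
  exact ⟨h, h' ▸ ht⟩

theorem isFlat (H : IsRegular L g lam Good) (hE : E.Integrable) :
    IsFlat M Good (L.Transport g lam) where
  exists_unique s _ hu := H.edge hu (isEdge_step s)
  good s _ _ hu h := H.good hu (isEdge_step s) h
  symm s u w h := by
    unfold Transport
    rw [source_revStep, target_revStep]
    exact hE.symmetric.flip_first (L.label_mem _) H.mem h
  quad d hd u u₁ u₂ w₁ w₂ hu h₁ h₂ h₃ h₄ := by
    simp only [Transport, source, target, if_true, Bool.false_eq_true, if_false] at h₁ h₂ h₃ h₄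
    -- The steps are indexed by sides of both polygons; the gluing identities rewrite their ends and
    -- labels as those of the single quadrilateral `IsQuad.black d`.
    rw [face_next, ← org_opp hd, ← L.label_next_opp d hd] at h₂
    rw [face_next, org_next_opp hd] at h₃
    rw [L.label_opp d hd] at h₄
    exact (H.cube hE.consistent hu (.black d hd) h₁ h₃ h₂ h₄).1

theorem exists_field (H : IsRegular L g lam Good) (hE : E.Integrable) (hc : M.Connected)
    (hs : M.SimplyConnected) {v : M.Vertex} {u : ℂ} (hu : Good v u) :
    ∃ F : M.Vertex → ℂ, F v = u ∧ (∀ w, Good w (F w)) ∧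
      (∀ v v1 a, L.IsEdge v v1 a → E.Q (g v) (g v1) (F v) (F v1) a lam = 0) ∧
      ∀ {v00 v10 v01 v11 : M.Vertex} {a b : ℂ}, L.IsQuad v00 v10 v01 v11 a b →
        E.Q (F v00) (F v10) (F v01) (F v11) a b = 0 := by
  obtain ⟨F, hv, hg, hF⟩ := (H.isFlat hE).exists_section hc hs hu
  have hF' : ∀ v v1 a, L.IsEdge v v1 a → E.Q (g v) (g v1) (F v) (F v1) a lam = 0 := by
    intro v v1 a h
    obtain ⟨s, rfl, rfl, rfl⟩ := h.exists_step
    exact hF s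
  refine ⟨F, hv, hg, hF', fun hq => ?_⟩
  obtain ⟨e1, e2, e3, e4⟩ := hq.edges
  exact (H.cube hE.consistent (hg _) hq (hF' _ _ _ e1) (hF' _ _ _ e3) (hF' _ _ _ e4)
    (hF' _ _ _ e2)).2

theorem field_unique (H : IsRegular L g lam Good) (hE : E.Integrable) (hc : M.Connected)
    {F G : M.Vertex → ℂ} {v : M.Vertex} (hv : Good v (F v)) (h : G v = F v)
    (hF : ∀ v v1 a, L.IsEdge v v1 a → E.Q (g v) (g v1) (F v) (F v1) a lam = 0)
    (hG : ∀ v v1 a, L.IsEdge v v1 a → E.Q (g v) (g v1) (G v) (G v1) a lam = 0) : G = F :=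
  (H.isFlat hE).section_unique hc hv h (fun s => hF _ _ _ (isEdge_step s))
    fun s => hG _ _ _ (isEdge_step s)

end IsRegular

/-! ### The two floors and the equations over the boundary. -/

namespace GeneralPosition

variable {g : M.Vertex → ℂ} {lam : ℂ} {v0 : M.Vertex} {c : ℂ}

theorem isRegular_first (H : L.GeneralPosition g lam v0 c) (hlam : lam ∈ E.params)
    (hg : L.IsSolution g) : IsRegular L g lam (L.FirstFloor g lam v0 c) where
  mem := hlam
  quad_eq := hg.1 _ _ _ _ _ _
  quad := H.ground_quad
  edge := H.first_edge
  good := .step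
  upper_quad := H.first_quad

theorem isRegular_second (H : L.GeneralPosition g lam v0 c) (hlam : lam ∈ E.params)
    {f : M.Vertex → ℂ} (hf : ∀ v, L.FirstFloor g lam v0 c v (f v))
    (hgf : ∀ v v1 a, L.IsEdge v v1 a → E.Q (g v) (g v1) (f v) (f v1) a lam = 0)
    (hfq : ∀ {v00 v10 v01 v11 : M.Vertex} {a b : ℂ}, L.IsQuad v00 v10 v01 v11 a b →
        E.Q (f v00) (f v10) (f v01) (f v11) a b = 0) :
    IsRegular L f (E.σ lam) (fun v w => L.SecondFloor g lam v0 c v (f v) w) where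
  mem := E.σ_mem _ hlam
  quad_eq := hfq
  quad hq := H.first_quad (hf _) hq (hgf _ _ _ hq.edges.1) (hgf _ _ _ hq.edges.2.2.1)
  edge hu he := H.second_edge hu he (hgf _ _ _ he)
  good hu he h := .step hu he (hgf _ _ _ he) h
  upper_quad hu hq h10 h01 :=
    H.second_quad hu hq (hgf _ _ _ hq.edges.1) (hgf _ _ _ hq.edges.2.2.1) h10 h01

/-- If the boundary equation holds on the vertical triangle over one end of a boundary edge, it holds
over the other end and on the upper floor. -/
theorem half_dodecahedron (H : L.GeneralPosition g lam v0 c) (hlam : lam ∈ E.params)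
    (hE : E.Integrable) (hg : L.IsSolution g) {f gp : M.Vertex → ℂ}
    (hf : ∀ v, L.FirstFloor g lam v0 c v (f v))
    (hgp : ∀ v, L.SecondFloor g lam v0 c v (f v) (gp v))
    (hgf : ∀ v v1 a, L.IsEdge v v1 a → E.Q (g v) (g v1) (f v) (f v1) a lam = 0)
    (hfgp : ∀ v v1 a, L.IsEdge v v1 a → E.Q (f v) (f v1) (gp v) (gp v1) a (E.σ lam) = 0)
    {x y z : M.Vertex} {a : ℂ} (ht : L.IsTriangle x y z a)
    (hx : E.q (g x) (f x) (gp x) lam = 0) :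
    E.q (g z) (f z) (gp z) lam = 0 ∧ E.q (gp x) (gp y) (gp z) a = 0 := by
  obtain ⟨e1, e2⟩ := ht.edges
  obtain ⟨bx, bz⟩ := ht.isBoundaryVertex
  have S := hE.symmetric
  have ha := e1.mem
  have hsa := e2.mem
  have hsl := E.σ_mem _ hlam
  obtain ⟨r, hr, -⟩ := H.boundary_vertex (hf z) bz
  obtain ⟨s, hs, -⟩ :=
    H.second_triangle (hgp x) ht (hgf _ _ _ e1) (hfgp _ _ _ e1)
  have key : r = s ∧ s = gp z := by
    -- Here `x, x1, y2` are the ground values, `x2, y1, z2` those of `f`, and `y3, z1, w` those of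
    -- `gp`, each on the triangle in its chosen order. The third way to compute `w` is the
    -- quadrilateral above the edge `y z`, whose solution is already `gp z`. The symmetries only
    -- bring the bulk equations into the required reading order.
    refine hE.boundary_consistent a ha lam hlam (g x) (g y) (f x) (f y) (g z) (gp x)
      (gp y) (f z) r s (gp z) ?_ ?_ ?_ ?_ ?_ ?_ ?_ ?_
    · have := isOnlyRoot_of_existsUnique (H.first_edge (hf x) e1) (hgf _ _ _ e1)
      intro u
      rw [← this u]
      exact ⟨fun k => S.flip_second ha hlam (S.flip_first ha hlam k),
        fun k => S.flip_second ha hlam (S.flip_first ha hlam k)⟩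
    · exact isOnlyRoot_of_existsUnique (H.ground_triangle ht) (hg.2 _ _ _ _ ht)
    · exact isOnlyRoot_of_existsUnique (H.boundary_vertex (hf x) bx) hx
    · have := isOnlyRoot_of_existsUnique (H.second_edge (hgp x) e1 (hgf _ _ _ e1)) (hfgp _ _ _ e1)
      intro u
      rw [← this u]
      exact ⟨fun k => S.flip_first ha hsl (S.swap hsl ha k),
        fun k => S.swap ha hsl (S.flip_first ha hsl k)⟩
    · have := isOnlyRoot_of_existsUnique (H.first_edge (hf y) e2) (hgf _ _ _ e2)
      intro u
      rw [← this u]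
      exact ⟨S.flip_second hsa hlam, S.flip_second hsa hlam⟩
    · exact isOnlyRoot_of_existsUnique (H.boundary_vertex (hf z) bz) hr
    · exact isOnlyRoot_of_existsUnique
        (H.second_triangle (hgp x) ht (hgf _ _ _ e1) (hfgp _ _ _ e1)) hs
    · have := isOnlyRoot_of_existsUnique (H.second_edge (hgp y) e2 (hgf _ _ _ e2)) (hfgp _ _ _ e2)
      intro u
      rw [← this u]
      exact ⟨S.swap hsl hsa, S.swap hsa hsl⟩
  obtain ⟨rfl, rfl⟩ := key
  exact ⟨hr, hs⟩

/-- The boundary equation holds on the vertical triangle over one end of a boundary edge if and only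
if it holds over the other end. -/
theorem boundary_eq (H : L.GeneralPosition g lam v0 c) (hlam : lam ∈ E.params)
    (hE : E.Integrable) (hg : L.IsSolution g) (hc : M.Connected) (hs : M.SimplyConnected)
    {f : M.Vertex → ℂ} (hf : ∀ v, L.FirstFloor g lam v0 c v (f v))
    (hgf : ∀ v v1 a, L.IsEdge v v1 a → E.Q (g v) (g v1) (f v) (f v1) a lam = 0)
    (hfq : ∀ {v00 v10 v01 v11 : M.Vertex} {a b : ℂ}, L.IsQuad v00 v10 v01 v11 a b →
        E.Q (f v00) (f v10) (f v01) (f v11) a b = 0)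
    {x y z : M.Vertex} {a : ℂ} (ht : L.IsTriangle x y z a) {gp : M.Vertex → ℂ}
    (hgp : ∀ v, L.SecondFloor g lam v0 c v (f v) (gp v))
    (hfgp : ∀ v v1 a, L.IsEdge v v1 a → E.Q (f v) (f v1) (gp v) (gp v1) a (E.σ lam) = 0) :
    E.q (g x) (f x) (gp x) lam = 0 ↔ E.q (g z) (f z) (gp z) lam = 0 := by
  refine ⟨fun h => (H.half_dodecahedron hlam hE hg hf hgp hgf hfgp ht h).1, fun h => ?_⟩
  obtain ⟨bx, bz⟩ := ht.isBoundaryVertex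
  have R := H.isRegular_second hlam hf hgf hfq
  -- The triangle cannot be crossed backwards directly. Instead a second field `G` is built from the
  -- solution over `x`; the forward direction gives the equation for `G` over `z`, so `G` and `gp`
  -- agree at `z` and hence everywhere.
  obtain ⟨w, hw, -⟩ := H.boundary_vertex (hf x) bx
  obtain ⟨G, rfl, hG, hfG, -⟩ := R.exists_field hE hc hs (v := x) (.base (hf x) bx hw)
  have hz := (H.half_dodecahedron hlam hE hg hf hG hgf hfG ht hw).1
  have : G = gp :=
    R.field_unique hE hc (hgp z) ((H.boundary_vertex (hf z) bz).unique hz h) hfgp hfG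
  exact this ▸ hw

end GeneralPosition

/-! ### Propagation along the connected boundary. -/

theorem exists_isTriangle (L : Labelling M E) {d : D} (h : M.IsBoundary d) :
    (∃ a, L.IsTriangle (M.org d) (M.face d) (M.org (M.next d)) a) ∨
      ∃ a, L.IsTriangle (M.org (M.next d)) (M.face d) (M.org d) a := by
  cases hf : L.forward d with
  | true => exact .inl ⟨_, .forward d h hf⟩
  | false => exact .inr ⟨_, .backward d h hf⟩

/-- A property of vertices that agrees at the ends of each boundary edge agrees at all boundary
vertices. -/
theorem boundary_induction (L : Labelling M E) (hb : M.ConnectedBoundary) {p : M.Vertex → Prop}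
    (h : ∀ {x y z : M.Vertex} {a : ℂ}, L.IsTriangle x y z a → (p x ↔ p z))
    {v w : M.Vertex} (hv : M.IsBoundaryVertex v) (hw : M.IsBoundaryVertex w) : p v ↔ p w := by
  have key : ∀ d, M.IsBoundary d → (p (M.org d) ↔ p (M.org (M.next d))) := by
    intro d hd
    rcases L.exists_isTriangle hd with ⟨a, ht⟩ | ⟨a, ht⟩
    · exact h ht
    · exact (h ht).symm
  have chain : ∀ d e, M.IsBoundary d → M.IsBoundary e → (p (M.org d) ↔ p (M.org e)) := by
    intro d e hd he
    have := hb.2 d e hd he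
    -- Intermediate sides of the chain need no separate boundary hypothesis: each link contains its
    -- own.
    clear hd he
    induction this with
    | rel d e k => rw [key d k.1, k.2.2]
    | refl => rfl
    | symm _ _ _ ih => exact ih.symm
    | trans _ _ _ _ _ ih₁ ih₂ => exact ih₁.trans ih₂
  have aux : ∀ v, M.IsBoundaryVertex v → ∃ d, M.IsBoundary d ∧ (p v ↔ p (M.org d)) := by
    rintro v ⟨d, hd, rfl | rfl⟩
    · exact ⟨d, hd, Iff.rfl⟩
    · exact ⟨d, hd, (key d hd).symm⟩
  obtain ⟨d, hd, h₁⟩ := aux v hv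
  obtain ⟨e, he, h₂⟩ := aux w hw
  exact h₁.trans ((chain d e hd he).trans h₂.symm)

end Labelling

theorem mainTheorem2 {D : Type*} (M : CellDecomposition D)
    (hconn : M.Connected) (hsimply : M.SimplyConnected) (hbdry : M.ConnectedBoundary)
    (E : BoundarySystem) (hE : E.Integrable) (L : Labelling M E)
    (g : M.Vertex → ℂ) (hg : L.IsSolution g) :
    ∀ lam ∈ E.params, ∀ (v0 : M.Vertex) (c : ℂ), L.GeneralPosition g lam v0 c →
      ∃ f gp : M.Vertex → ℂ,
        f v0 = c ∧ L.IsBacklundPair g lam f gp ∧ L.IsSolution gp ∧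
        ∀ f' gp' : M.Vertex → ℂ, f' v0 = c → L.IsBacklundPair g lam f' gp' →
          f' = f ∧ gp' = gp := by
  intro lam hlam v0 c H
  have R₁ := H.isRegular_first hlam hg
  obtain ⟨f, hv0, hf, hgf, hfq⟩ := R₁.exists_field hE hconn hsimply (v := v0) .base
  have R₂ := H.isRegular_second hlam hf hgf hfq
  -- The second floor has no prescribed value; it is started above an arbitrary boundary vertex,
  -- which exists as the boundary is nonempty.
  obtain ⟨d, hd⟩ := hbdry.1
  have bd : M.IsBoundaryVertex (M.org d) := ⟨d, hd, .inl rfl⟩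
  obtain ⟨w, hw, -⟩ := H.boundary_vertex (hf (M.org d)) bd
  obtain ⟨gp, rfl, hgp, hfgp, hgpq⟩ :=
    R₂.exists_field hE hconn hsimply (v := M.org d) (.base (hf _) bd hw)
  have hb : ∀ v, M.IsBoundaryVertex v → E.q (g v) (f v) (gp v) lam = 0 := fun v hv =>
    (L.boundary_induction hbdry (p := fun v => E.q (g v) (f v) (gp v) lam = 0)
      (fun ht => H.boundary_eq hlam hE hg hconn hsimply hf hgf hfq ht hgp hfgp) bd hv).1 hw
  refine ⟨f, gp, hv0, ⟨hgf, hfgp, hb⟩, ⟨fun _ _ _ _ _ _ hq => hgpq hq, fun x y z a ht =>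
    (H.half_dodecahedron hlam hE hg hf hgp hgf hfgp ht (hb x ht.isBoundaryVertex.1)).2⟩, ?_⟩
  intro f' gp' h0 h'
  obtain rfl : f' = f := R₁.field_unique hE hconn (hf v0) (h0.trans hv0.symm) hgf h'.ground_first
  -- The vertical boundary equation above `M.org d` fixes the value of `gp'` there, and a section is
  -- determined by one value.
  exact ⟨rfl, R₂.field_unique hE hconn (hgp (M.org d))
    ((H.boundary_vertex (hf _) bd).unique (h'.boundary _ bd) hw) hfgp h'.first_second⟩
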